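/- Let $D\subset\mathbb R^d$ be a bounded open set, and let $(P_t)_{t\ge 0}$ be a strongly continuous semigroup of contractions on $L^2(D)$ with generator $L$; let $L^*$ be the generator of the adjoint semigroup. Assume that there are $\lambda_0>0$ and strictly positive (a.e.) functions $\psi_0\in\mathrm{Dom}(L)$, $\phi_0\in\mathrm{Dom}(L^*)$ with $\int_D\psi_0\,dx=\int_D\phi_0\,dx=1$ and $$(L+\lambda_0)\psi_0=(L^*+\lambda_0)\phi_0=0 .$$ Let $\varphi\in L^\infty(D)$, $\varphi\ge 0$, and write $\langle\varphi,\phi_0\rangle_D=\int_D\varphi\,\phi_0\,dx$. Let $g:\mathbb R\to[0,\infty)$ be locally Lipschitz with $g(z)\ge Cz^{1+\beta}$ for all $z>0$, where $C>0$ and $\beta>0$ are constants. Let $k$ be a real function on $[0,\infty)$ with $k^2$ integrable on bounded intervals, let $a:[0,\infty)\to\mathbb R$ be continuous, let $H\in(1/2,1)$, and let $b:[0,\infty)\to\mathbb R$ be Hölder continuous on bounded intervals of order $\alpha>1-H$. Let $B$ be a Brownian motion and $B^H$ a fractional Brownian motion with Hurst parameter $H$, defined on the same filtered probability space $(\Omega,\mathcal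 F,(\mathcal F_t)_{t\ge0},\mathbb P)$ and adapted to $(\mathcal F_t)$, and let $$N_t=\int_0^t a(s)\,dB_s+\int_0^t b(s)\,dB^H_s,\qquad t\ge 0,$$ in a version with almost surely continuous paths, where the first integral is an Itô integral and the second one is a pathwise (generalized Riemann--Stieltjes) integral. Put $K(t)=\frac12\int_0^tk^2(s)\,ds$, $A(t)=\frac12\int_0^ta^2(s)\,ds$ and $$\tau^*=\inf\Big\{t>0:\int_0^t\exp\big[-\beta(\lambda_0K(r)+A(r))+\beta N_r\big]\,dr\ \ge\ \frac1{C\beta}\langle\varphi,\phi_0\rangle_D^{-\beta}\Big\},$$ with $\inf\emptyset=\infty$ and $0^{-\beta}=\infty$. Let $T\ge 0$. 1. Assume that for every $t\ge 0$, almost surely, $B^H_t=\int_0^tK^H(t,s)\,dW_s$, where $W$ is a Brownian motion on the same probability space, adapted to the same filtration (with no assumption on the joint law of $W$ and $B$), and $$K^H(t,s)=C_H\,s^{1/2-H}\int_s^t(\sigma-s)^{H-3/2}\sigma^{H-1/2}\,d\sigma\quad(s<t),\qquad C_H=\Big[\frac{H(2H-1)}{\mathcal B(2-2H,H-\frac12)}\Big]^{1/2},$$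 $\mathcal B$ being the beta function. Then $$\mathbb P(\tau^*\le T)\le C\beta\langle\varphi,\phi_0\rangle_D^{\beta}\int_0^T\Big[e^{-\beta\lambda_0\int_0^tk^2(s)ds+2\beta^2\int_0^ta^2(s)ds}+e^{-\beta\int_0^ta^2(s)ds+4\beta^2Ht^{2H-1}\int_0^tb^2(s)ds}\Big]dt .$$ 2. If the processes $B$ and $B^H$ are independent, then $$\mathbb P(\tau^*\le T)\le C\beta\langle\varphi,\phi_0\rangle_D^{\beta}\int_0^T\exp\Big\{-\beta\lambda_0K(t)+\frac{\beta^2-\beta}2\int_0^ta^2(s)\,ds+\beta^2Ht^{2H-1}\int_0^tb^2(s)\,ds\Big\}\,dt .$$ -/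

import Mathlib

open MeasureTheory ProbabilityTheory Filter Set Topology
open scoped NNReal ENNReal

noncomputable section

/-! ### Semigroups on a Hilbert space and their generators -/

/-- `S` is a strongly continuous semigroup of contractions. -/
structure IsContractionSemigroup {E : Type*} [NormedAddCommGroup E] [NormedSpace ℝ E]
    (S : ℝ≥0 → E →L[ℝ] E) : Prop where
  zero : S 0 = ContinuousLinearMap.id ℝ E
  add : ∀ s t, S (s + t) = (S s).comp (S t)
  contraction : ∀ t, ‖S t‖ ≤ 1
  continuous_at_zero : ∀ f, Tendsto (fun t => S t f) (𝓝 0) (𝓝 f)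

/-- `f` belongs to the domain of the infinitesimal generator `L` of the semigroup `S`, and
`L f = h`, that is `h = lim_{t ↓ 0} (S t f - f) / t` in norm. -/
def HasGenerator {E : Type*} [NormedAddCommGroup E] [NormedSpace ℝ E]
    (S : ℝ≥0 → E →L[ℝ] E) (f h : E) : Prop :=
  Tendsto (fun t : ℝ≥0 => (t : ℝ)⁻¹ • (S t f - f)) (𝓝[>] 0) (𝓝 h)

/-- The adjoint semigroup; its generator is the adjoint `L*` of the generator `L` of `S`. -/
def adjointSemigroup {E : Type*} [NormedAddCommGroup E] [InnerProductSpace ℝ E] [CompleteSpace E]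
    (S : ℝ≥0 → E →L[ℝ] E) (t : ℝ≥0) : E →L[ℝ] E :=
  ContinuousLinearMap.adjoint (S t)

/-- The real Hilbert space `L²(D)`. -/
abbrev L2 {d : ℕ} (D : Set (EuclideanSpace ℝ (Fin d))) : Type :=
  Lp ℝ 2 (volume.restrict D)

/-- `ψ₀ ∈ Dom(L)` and `φ₀ ∈ Dom(L*)` are strictly positive eigenfunctions of the generator `L` of
`S` and of its adjoint, `(L + λ₀) ψ₀ = (L* + λ₀) φ₀ = 0` with `λ₀ > 0`, of integral one. -/
structure ArePositiveEigenfunctions {d : ℕ} (D : Set (EuclideanSpace ℝ (Fin d)))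
    (S : ℝ≥0 → L2 D →L[ℝ] L2 D) (lam0 : ℝ) (psi0 phi0 : L2 D) : Prop where
  lam0_pos : 0 < lam0
  psi0_pos : ∀ᵐ x ∂(volume.restrict D), 0 < psi0 x
  phi0_pos : ∀ᵐ x ∂(volume.restrict D), 0 < phi0 x
  integral_psi0 : ∫ x in D, psi0 x = 1
  integral_phi0 : ∫ x in D, phi0 x = 1
  eigen_psi0 : HasGenerator S psi0 (-(lam0 • psi0))
  eigen_phi0 : HasGenerator (adjointSemigroup S) phi0 (-(lam0 • phi0))

/-- The pairing `⟨φ, φ₀⟩_D = ∫_D φ(x) φ₀(x) dx`. -/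
def pairing {d : ℕ} (D : Set (EuclideanSpace ℝ (Fin d)))
    (phi : EuclideanSpace ℝ (Fin d) → ℝ) (phi0 : L2 D) : ℝ :=
  ∫ x in D, phi x * phi0 x

/-! ### Fractional Brownian motion -/

/-- Fractional Brownian motion of Hurst parameter `H`: a centred Gaussian process with covariance
`(s^{2H} + t^{2H} - |t - s|^{2H}) / 2` and almost surely continuous paths. -/
structure IsFractionalBrownian {Ω : Type*} {mΩ : MeasurableSpace Ω} (H : ℝ)
    (X : ℝ≥0 → Ω → ℝ) (P : Measure Ω) : Prop where
  gaussian : IsGaussianProcess X P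
  centred : ∀ t, ∫ ω, X t ω ∂P = 0
  cov_eq : ∀ s t : ℝ≥0, covariance (X s) (X t) P =
    ((s : ℝ) ^ (2 * H) + (t : ℝ) ^ (2 * H) - |(t : ℝ) - s| ^ (2 * H)) / 2
  cont : ∀ᵐ ω ∂P, Continuous fun t => X t ω

/-- The constant `C_H = (H (2H - 1) / 𝓑(2 - 2H, H - 1/2))^{1/2}`, with the Euler beta function. -/
def kernelConst (H : ℝ) : ℝ :=
  Real.sqrt (H * (2 * H - 1) / ProbabilityTheory.beta (2 - 2 * H) (H - 1 / 2))

/-- The Volterra kernel `K^H(t, s)` of fractional Brownian motion for `H > 1/2`. -/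
def fbmKernel (H t s : ℝ) : ℝ :=
  if s < t then
    kernelConst H * s ^ (1 / 2 - H) *
      ∫ σ in s..t, (σ - s) ^ (H - 3 / 2) * σ ^ (H - 1 / 2)
  else 0

/-! ### The stochastic integrals of deterministic integrands -/

/-- The step function `∑ i, c i 1_{(s_i, s_{i+1}]}`. -/
def stepFun {n : ℕ} (c : Fin n → ℝ) (s : Fin (n + 1) → ℝ≥0) (r : ℝ) : ℝ :=
  ∑ i : Fin n, (Ioc (s i.castSucc : ℝ) (s i.succ : ℝ)).indicator (fun _ => c i) r

/-- The elementary integral `∑ i, c i (B_{s_{i+1}} - B_{s_i})` of a step function. -/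
def stepIntegral {Ω : Type*} (B : ℝ≥0 → Ω → ℝ) {n : ℕ} (c : Fin n → ℝ)
    (s : Fin (n + 1) → ℝ≥0) (ω : Ω) : ℝ :=
  ∑ i : Fin n, c i * (B (s i.succ) ω - B (s i.castSucc) ω)

/-- `I` is (a version of) the Itô--Wiener integral `∫_0^t f(s) dB_s` of the deterministic function
`f ∈ L²(0, t)` with respect to the Brownian motion `B`: the limit in `L²(P)` of the elementary
integrals of step functions which approximate `f` in `L²(0, t)`. By the Itô isometry this
determines `I` up to equality almost surely. -/
structure IsWienerIntegral {Ω : Type*} {mΩ : MeasurableSpace Ω} (B : ℝ≥0 → Ω → ℝ) (P : Measure Ω)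
    (f : ℝ → ℝ) (t : ℝ≥0) (I : Ω → ℝ) : Prop where
  memLp_fun : MemLp f 2 (volume.restrict (Ioc 0 (t : ℝ)))
  memLp : MemLp I 2 P
  approx : ∀ ε : ℝ≥0∞, 0 < ε → ∃ (n : ℕ) (c : Fin n → ℝ) (s : Fin (n + 1) → ℝ≥0),
    Monotone s ∧ s (Fin.last n) ≤ t ∧
    eLpNorm (fun r => f r - stepFun c s r) 2 (volume.restrict (Ioc 0 (t : ℝ))) ≤ ε ∧
    eLpNorm (fun ω => I ω - stepIntegral B c s ω) 2 P ≤ ε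

/-- `J` is the Riemann--Stieltjes integral `∫_0^t f(s) dg(s)`: the limit of the sums
`∑ f(ξ_i) (g(s_{i+1}) - g(s_i))` over tagged partitions of `[0, t]` as the mesh tends to `0`.
If `f` and `g` are Hölder continuous with exponents of sum larger than one then it exists and is
the (pathwise) fractional integral. -/
def IsStieltjesIntegral (f : ℝ → ℝ) (g : ℝ≥0 → ℝ) (t : ℝ≥0) (J : ℝ) : Prop :=
  ∀ ε : ℝ, 0 < ε → ∃ δ : ℝ, 0 < δ ∧
    ∀ (n : ℕ) (s : Fin (n + 1) → ℝ≥0) (ξ : Fin n → ℝ≥0),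
      Monotone s → s 0 = 0 → s (Fin.last n) = t →
      (∀ i : Fin n, s i.castSucc ≤ ξ i ∧ ξ i ≤ s i.succ) →
      (∀ i : Fin n, (s i.succ : ℝ) - s i.castSucc < δ) →
      |∑ i : Fin n, f (ξ i) * (g (s i.succ) - g (s i.castSucc)) - J| < ε

/-- `N` is the mixed process `N_t = ∫_0^t a(s) dB_s + ∫_0^t b(s) dB^H_s`, in a version with almost
surely continuous paths: the first integral is an Itô integral, the second one is pathwise. -/
structure IsMixedNoise {Ω : Type*} {mΩ : MeasurableSpace Ω} (P : Measure Ω) (a b : ℝ → ℝ)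
    (B BH : ℝ≥0 → Ω → ℝ) (N : ℝ≥0 → Ω → ℝ) : Prop where
  eq_integrals : ∀ t, ∃ I J : Ω → ℝ, IsWienerIntegral B P a t I ∧
    (∀ᵐ ω ∂P, IsStieltjesIntegral b (fun s => BH s ω) t (J ω)) ∧
    ∀ᵐ ω ∂P, N t ω = I ω + J ω
  cont : ∀ᵐ ω ∂P, Continuous fun t => N t ω

/-! ### The random time `τ*` -/

/-- `f ↦ ½ ∫_0^t f(r)² dr`: the function `K(t)` for `f = k` and `A(t)` for `f = a`. -/
def halfSq (f : ℝ → ℝ) (t : ℝ) : ℝ :=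
  (1 / 2) * ∫ r in (0 : ℝ)..t, f r ^ 2

/-- The level `(C β)⁻¹ p^{-β} ∈ (0, ∞]`, infinite when `p = 0`. -/
def tauLevel (C β p : ℝ) : ℝ≥0∞ :=
  (ENNReal.ofReal (C * β))⁻¹ * (ENNReal.ofReal p) ^ (-β)

/-- The random time
`τ* = inf {t > 0 : ∫_0^t exp(-β (λ₀ K(r) + A(r)) + β N_r) dr ≥ (C β)⁻¹ p^{-β}}` (`inf ∅ = ∞`);
here `p` stands for `⟨φ, φ₀⟩_D`. -/
def tauStar {Ω : Type*} (C β lam0 p : ℝ) (k a : ℝ → ℝ) (N : ℝ≥0 → Ω → ℝ) (ω : Ω) : ℝ≥0∞ :=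
  sInf ((fun t : ℝ≥0 => (t : ℝ≥0∞)) '' {t : ℝ≥0 | 0 < t ∧
    tauLevel C β p ≤ ∫⁻ r in Ioc 0 (t : ℝ), ENNReal.ofReal
      (Real.exp (-β * (lam0 * halfSq k r + halfSq a r) + β * N r.toNNReal ω))})

end

/-! ### Weighted increments of centred Gaussian processes -/

/-! On `τ* ≤ T` the increasing functional defining `τ*` has reached its level by time `T`, so
Markov's inequality and Tonelli (`measureReal_tauStar_le`) reduce both claims to bounding the
exponential moment of `N r` at each fixed `r`.

There `N = I + J`, and each summand is an almost sure limit of centred Gaussian sums. For the Itô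
part the variances tend to `∫ a²`. For the fractional part they are at most `2H t^(2H-1) ∫ b²`: when
`H > 1/2` increments are nonnegatively correlated, and each row of their covariance matrix
telescopes, so Schur's test applies (`IsFractionalBrownian.variance_stepIntegral_le`). Only upper
bounds on moments are wanted, so Fatou carries them to the limit.

Under independence the exponential moments multiply. For an arbitrary joint law, `exp (x + y) ≤ exp
(2x) + exp (2y)` separates `I` from `J`, at the price of doubled exponents. -/

theorem lintegral_exp_mul_of_hasGaussianLaw {Ω : Type*} {mΩ : MeasurableSpace Ω}
    {P : Measure Ω} {X : Ω → ℝ} (hX : HasGaussianLaw X P) (h0 : ∫ ω, X ω ∂P = 0) (l : ℝ) :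
    ∫⁻ ω, ENNReal.ofReal (Real.exp (l * X ω)) ∂P
      = ENNReal.ofReal (Real.exp (l ^ 2 / 2 * variance X P)) := by
  have hmap := hX.map_eq_gaussianReal
  have hint : Integrable (fun ω => Real.exp (l * X ω)) P := by
    have h := integrable_exp_mul_gaussianReal (μ := ∫ ω, X ω ∂P) (v := (variance X P).toNNReal) l
    rw [← hmap] at h
    exact (integrable_map_measure (by fun_prop) hX.aemeasurable).1 h
  rw [← ofReal_integral_eq_lintegral_ofReal hint (ae_of_all _ fun _ => (Real.exp_pos _).le)]
  have h := mgf_gaussianReal hmap l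
  rw [mgf, h0, Real.coe_toNNReal _ (variance_nonneg _ _)] at h
  rw [h]
  ring_nf

/-- The increment of `X` over the `i`-th interval of the partition `s`. -/
def incr {Ω : Type*} (X : ℝ≥0 → Ω → ℝ) {n : ℕ} (s : Fin (n + 1) → ℝ≥0) (i : Fin n) (ω : Ω) : ℝ :=
  X (s i.succ) ω - X (s i.castSucc) ω

theorem ProbabilityTheory.IsGaussianProcess.memLp_incr {Ω : Type*} {mΩ : MeasurableSpace Ω}
    {P : Measure Ω} {X : ℝ≥0 → Ω → ℝ} (hX : IsGaussianProcess X P) {n : ℕ}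
    (s : Fin (n + 1) → ℝ≥0) (i : Fin n) : MemLp (incr X s i) 2 P :=
  (hX.hasGaussianLaw_fun_sub (s := s i.succ) (t := s i.castSucc)).memLp_two

theorem ProbabilityTheory.IsGaussianProcess.hasGaussianLaw_stepIntegral {Ω : Type*}
    {mΩ : MeasurableSpace Ω} {P : Measure Ω} {X : ℝ≥0 → Ω → ℝ} (hX : IsGaussianProcess X P) {n : ℕ}
    (c : Fin n → ℝ) (s : Fin (n + 1) → ℝ≥0) : HasGaussianLaw (stepIntegral X c s) P := by
  let L : (Fin n → ℝ) →L[ℝ] ℝ := ∑ i : Fin n, c i • ContinuousLinearMap.proj i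
  have he : stepIntegral X c s = L ∘ fun ω i => X (s i.succ) ω - X (s i.castSucc) ω := by
    ext ω
    simp [stepIntegral, L]
  rw [he]
  exact (hX.hasGaussianLaw_increments (t := s)).map L

theorem integral_stepIntegral {Ω : Type*} {mΩ : MeasurableSpace Ω} {P : Measure Ω}
    {X : ℝ≥0 → Ω → ℝ} (hX : IsGaussianProcess X P) (h0 : ∀ t, ∫ ω, X t ω ∂P = 0) {n : ℕ}
    (c : Fin n → ℝ) (s : Fin (n + 1) → ℝ≥0) : ∫ ω, stepIntegral X c s ω ∂P = 0 := by
  have hi : ∀ t, Integrable (X t) P := fun t => (hX.hasGaussianLaw_eval t).integrable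
  have hint : ∀ i ∈ Finset.univ,
      Integrable (fun ω => c i * (X (s i.succ) ω - X (s i.castSucc) ω)) P :=
    fun i _ => ((hi _).sub (hi _)).const_mul _
  simp only [stepIntegral]
  rw [integral_finsetSum _ hint]
  refine Finset.sum_eq_zero fun i _ => ?_
  rw [integral_const_mul, integral_sub (hi _) (hi _), h0, h0]
  simp

theorem variance_stepIntegral {Ω : Type*} {mΩ : MeasurableSpace Ω} {P : Measure Ω}
    {X : ℝ≥0 → Ω → ℝ} (hX : IsGaussianProcess X P) {n : ℕ}
    (c : Fin n → ℝ) (s : Fin (n + 1) → ℝ≥0) :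
    variance (stepIntegral X c s) P
      = ∑ i, ∑ j, c i * c j * covariance (incr X s i) (incr X s j) P := by
  have := hX.isProbabilityMeasure
  have h : variance (fun ω => ∑ i, c i * incr X s i ω) P = _ :=
    variance_fun_sum fun i => (hX.memLp_incr s i).const_mul (c i)
  rw [show stepIntegral X c s = fun ω => ∑ i, c i * incr X s i ω from rfl, h]
  refine Finset.sum_congr rfl fun i _ => Finset.sum_congr rfl fun j _ => ?_
  rw [covariance_const_mul_left, covariance_const_mul_right]
  ring

theorem covariance_incr_incr {Ω : Type*} {mΩ : MeasurableSpace Ω} {P : Measure Ω}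
    {X : ℝ≥0 → Ω → ℝ} (hX : IsGaussianProcess X P) {n : ℕ} (s : Fin (n + 1) → ℝ≥0)
    (i j : Fin n) :
    covariance (incr X s i) (incr X s j) P
      = covariance (X (s i.succ)) (X (s j.succ)) P - covariance (X (s i.succ)) (X (s j.castSucc)) P
        - covariance (X (s i.castSucc)) (X (s j.succ)) P
        + covariance (X (s i.castSucc)) (X (s j.castSucc)) P := by
  have := hX.isProbabilityMeasure
  exact covariance_fun_sub_fun_sub (hX.hasGaussianLaw_eval _).memLp_two
    (hX.hasGaussianLaw_eval _).memLp_two (hX.hasGaussianLaw_eval _).memLp_two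
    (hX.hasGaussianLaw_eval _).memLp_two

theorem Fin.sum_succ_sub_castSucc {n : ℕ} (f : Fin (n + 1) → ℝ) :
    ∑ i : Fin n, (f i.succ - f i.castSucc) = f (Fin.last n) - f 0 := by
  induction n with
  | zero => simp
  | succ n ih =>
    rw [Fin.sum_univ_castSucc]
    have h := ih (fun i => f i.castSucc)
    simp only [Fin.succ_castSucc, Fin.succ_last, Fin.castSucc_zero] at h ⊢
    rw [h]
    ring

/-- The Itô isometry for step functions. -/
theorem variance_stepIntegral_brownian {Ω : Type*} {mΩ : MeasurableSpace Ω} {P : Measure Ω}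
    {B : ℝ≥0 → Ω → ℝ} (hB : IsPreBrownianReal B P) {n : ℕ} (c : Fin n → ℝ)
    (s : Fin (n + 1) → ℝ≥0) (hs : Monotone s) {t : ℝ≥0} (ht : s (Fin.last n) ≤ t) :
    variance (stepIntegral B c s) P = ∫ r in Ioc 0 (t : ℝ), stepFun c s r ^ 2 := by
  have hsub : ∀ i : Fin n, Ioc (s i.castSucc : ℝ) (s i.succ) ⊆ Ioc 0 (t : ℝ) := fun i =>
    Ioc_subset_Ioc (s i.castSucc).2 (NNReal.coe_le_coe.2 ((hs (Fin.le_last _)).trans ht))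
  have hle : ∀ i : Fin n, (s i.castSucc : ℝ) ≤ s i.succ := fun i =>
    NNReal.coe_le_coe.2 (hs (Fin.castSucc_lt_succ).le)
  have hsq : ∀ r, stepFun c s r ^ 2 = ∑ i, ∑ j,
      (Ioc (s i.castSucc : ℝ) (s i.succ) ∩ Ioc (s j.castSucc : ℝ) (s j.succ)).indicator
        (fun _ => c i * c j) r := by
    intro r
    rw [stepFun, sq, Finset.sum_mul_sum]
    refine Finset.sum_congr rfl fun i _ => Finset.sum_congr rfl fun j _ => ?_
    rw [Set.inter_indicator_mul]
  have hint : ∀ i j : Fin n, Integrable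
      ((Ioc (s i.castSucc : ℝ) (s i.succ) ∩ Ioc (s j.castSucc : ℝ) (s j.succ)).indicator
        (fun _ => c i * c j)) (volume.restrict (Ioc 0 (t : ℝ))) := fun i j =>
    (integrable_const _).indicator (measurableSet_Ioc.inter measurableSet_Ioc)
  simp only [hsq]
  rw [integral_finsetSum _ fun i _ => integrable_finsetSum _ fun j _ => hint i j,
    variance_stepIntegral hB.isGaussianProcess]
  refine Finset.sum_congr rfl fun i _ => ?_
  rw [integral_finsetSum _ fun j _ => hint i j]
  refine Finset.sum_congr rfl fun j _ => ?_
  rw [integral_indicator (measurableSet_Ioc.inter measurableSet_Ioc),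
    Measure.restrict_restrict (measurableSet_Ioc.inter measurableSet_Ioc),
    inter_eq_left.2 (inter_subset_left.trans (hsub i)), Ioc_inter_Ioc, setIntegral_const,
    measureReal_def, Real.volume_Ioc, covariance_incr_incr hB.isGaussianProcess]
  simp only [hB.covariance_eval, NNReal.coe_min, smul_eq_mul]
  rw [mul_comm]
  congr 1
  have h1 := hle i
  have h2 := hle j
  -- The overlap of two intervals has length `max (min - max) 0`, which equals the second difference
  -- of `min` whatever the position of the intervals; hence no ordering of `i` and `j` is needed.
  rw [ENNReal.toReal_ofReal']
  simp only [min_def, max_def]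
  split_ifs <;> linarith

/-! ### Increments of fractional Brownian motion -/

/-- Both `x + h` and `y` are convex combinations of `x` and `y + h`, with the two weights exchanged;
adding the two convexity inequalities gives the claim. -/
theorem ConvexOn.add_le_add_of_le {f : ℝ → ℝ} (hf : ConvexOn ℝ univ f) {x y h : ℝ} (hxy : x ≤ y)
    (hh : 0 ≤ h) : f (x + h) + f y ≤ f x + f (y + h) := by
  rcases hh.eq_or_lt with rfl | hh'
  · simp
  have hL : 0 < y - x + h := by linarith
  have hu : 0 ≤ (y - x) / (y - x + h) := div_nonneg (by linarith) hL.le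
  have hv : 0 ≤ h / (y - x + h) := div_nonneg hh hL.le
  have huv : (y - x) / (y - x + h) + h / (y - x + h) = 1 := by field_simp
  have h1 := hf.2 (mem_univ x) (mem_univ (y + h)) hu hv huv
  have h2 := hf.2 (mem_univ x) (mem_univ (y + h)) hv hu (by rw [add_comm, huv])
  simp only [smul_eq_mul] at h1 h2
  rw [show (y - x) / (y - x + h) * x + h / (y - x + h) * (y + h) = x + h by field_simp; ring] at h1
  rw [show h / (y - x + h) * x + (y - x) / (y - x + h) * (y + h) = y by field_simp; ring] at h2
  have h3 : f (x + h) + f y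
      ≤ ((y - x) / (y - x + h) + h / (y - x + h)) * (f x + f (y + h)) := by linarith
  rwa [huv, one_mul] at h3

theorem convexOn_abs_rpow {p : ℝ} (hp : 1 ≤ p) : ConvexOn ℝ univ fun x : ℝ => |x| ^ p := by
  refine ConvexOn.comp (g := fun x : ℝ => x ^ p) (f := fun x : ℝ => |x|) ?_ ?_ ?_
  · refine (convexOn_rpow hp).subset ?_ ?_
    · rintro _ ⟨x, -, rfl⟩
      exact abs_nonneg x
    · rw [show (fun x : ℝ => |x|) '' univ = Ici 0 from ?_]
      · exact convex_Ici 0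
      · ext y
        exact ⟨by rintro ⟨x, -, rfl⟩; exact abs_nonneg x, fun hy => ⟨y, trivial, abs_of_nonneg hy⟩⟩
  · exact convexOn_norm (E := ℝ) convex_univ
  · rintro _ ⟨x, -, rfl⟩ y - hxy
    exact Real.rpow_le_rpow (abs_nonneg x) hxy (by linarith)

theorem rpow_sub_rpow_le {p x y t : ℝ} (hp : 1 ≤ p) (hx : 0 ≤ x) (hxy : x ≤ y) (hyt : y ≤ t) :
    y ^ p - x ^ p ≤ p * t ^ (p - 1) * (y - x) := by
  have hd : ∀ z : ℝ, HasDerivAt (fun z : ℝ => z ^ p) (p * z ^ (p - 1)) z := fun z =>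
    Real.hasDerivAt_rpow_const (Or.inr hp)
  refine Convex.image_sub_le_mul_sub_of_deriv_le (f := fun z : ℝ => z ^ p) (convex_Icc 0 t)
    (fun z _ => (hd z).continuousAt.continuousWithinAt)
    (fun z _ => (hd z).differentiableAt.differentiableWithinAt) ?_ x ⟨hx, hxy.trans hyt⟩ y
    ⟨hx.trans hxy, hyt⟩ hxy
  intro z hz
  rw [interior_Icc] at hz
  rw [(hd z).deriv]
  have := Real.rpow_le_rpow hz.1.le hz.2.le (sub_nonneg.2 hp)
  gcongr

/-- The one-variable powers cancel in a second difference, so only powers of the lags remain. -/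
theorem IsFractionalBrownian.covariance_sub_sub {Ω : Type*} {mΩ : MeasurableSpace Ω}
    {P : Measure Ω} {H : ℝ} {X : ℝ≥0 → Ω → ℝ} (hX : IsFractionalBrownian H X P) (a b c d : ℝ≥0) :
    covariance (X b) (X d) P - covariance (X b) (X c) P - covariance (X a) (X d) P
        + covariance (X a) (X c) P
      = (|(d : ℝ) - a| ^ (2 * H) + |(c : ℝ) - b| ^ (2 * H)
          - |(d : ℝ) - b| ^ (2 * H) - |(c : ℝ) - a| ^ (2 * H)) / 2 := by
  simp only [hX.cov_eq]
  ring

/-- The covariance is half a second difference of `|x| ^ (2H)`, which is convex since `2H ≥ 1`. -/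
theorem IsFractionalBrownian.covariance_incr_nonneg {Ω : Type*} {mΩ : MeasurableSpace Ω}
    {P : Measure Ω} {H : ℝ} {X : ℝ≥0 → Ω → ℝ} (hX : IsFractionalBrownian H X P) (hH : 1 / 2 < H)
    {n : ℕ} {s : Fin (n + 1) → ℝ≥0} (hs : Monotone s) (i j : Fin n) :
    0 ≤ covariance (incr X s i) (incr X s j) P := by
  rw [covariance_incr_incr hX.gaussian, hX.covariance_sub_sub]
  have hle : ∀ i : Fin n, (s i.castSucc : ℝ) ≤ s i.succ := fun i =>
    NNReal.coe_le_coe.2 (hs (Fin.castSucc_lt_succ).le)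
  have h := (convexOn_abs_rpow (p := 2 * H) (by linarith)).add_le_add_of_le
    (x := s j.castSucc - s i.succ) (y := s j.succ - s i.succ) (h := s i.succ - s i.castSucc)
    (by linarith [hle j]) (by linarith [hle i])
  simp only [sub_add_sub_cancel] at h
  linarith

/-- The row telescopes to the covariance of one increment, over `[u, v]` say, with the total
increment over `[0, t]`. This is half of `(v^(2H) - u^(2H)) + ((t-u)^(2H) - (t-v)^(2H))`, and the
mean value theorem bounds each bracket by `2H t^(2H-1) (v - u)`. -/
theorem IsFractionalBrownian.sum_covariance_incr_le {Ω : Type*} {mΩ : MeasurableSpace Ω}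
    {P : Measure Ω} {H : ℝ} {X : ℝ≥0 → Ω → ℝ} (hX : IsFractionalBrownian H X P) (hH : 1 / 2 < H)
    {n : ℕ} {s : Fin (n + 1) → ℝ≥0} (hs : Monotone s) (h0 : s 0 = 0) (i : Fin n) :
    ∑ j, covariance (incr X s i) (incr X s j) P
      ≤ 2 * H * (s (Fin.last n) : ℝ) ^ (2 * H - 1) * (s i.succ - s i.castSucc) := by
  have hG := hX.gaussian
  have hrow : ∑ j, covariance (incr X s i) (incr X s j) P
      = ∑ j : Fin n, ((covariance (X (s i.succ)) (X (s j.succ)) P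
            - covariance (X (s i.castSucc)) (X (s j.succ)) P)
          - (covariance (X (s i.succ)) (X (s j.castSucc)) P
            - covariance (X (s i.castSucc)) (X (s j.castSucc)) P)) :=
    Finset.sum_congr rfl fun j _ => by rw [covariance_incr_incr hG]; ring
  rw [hrow, Fin.sum_succ_sub_castSucc fun j => covariance (X (s i.succ)) (X (s j)) P
    - covariance (X (s i.castSucc)) (X (s j)) P]
  have hcov := hX.covariance_sub_sub (s i.castSucc) (s i.succ) (s 0) (s (Fin.last n))
  have ha : (0 : ℝ) ≤ s i.castSucc := (s i.castSucc).2
  have hab : (s i.castSucc : ℝ) ≤ s i.succ := NNReal.coe_le_coe.2 (hs (Fin.castSucc_lt_succ).le)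
  have hbt : (s i.succ : ℝ) ≤ s (Fin.last n) := NNReal.coe_le_coe.2 (hs (Fin.le_last _))
  have h1 := rpow_sub_rpow_le (p := 2 * H) (by linarith) ha hab hbt
  have h2 := rpow_sub_rpow_le (p := 2 * H) (x := s (Fin.last n) - s i.succ)
    (y := s (Fin.last n) - s i.castSucc) (t := s (Fin.last n)) (by linarith) (by linarith)
    (by linarith) (by linarith)
  rw [h0, NNReal.coe_zero, zero_sub, zero_sub, abs_neg, abs_neg, abs_of_nonneg ha,
    abs_of_nonneg (ha.trans hab), abs_of_nonneg (sub_nonneg.2 hbt),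
    abs_of_nonneg (sub_nonneg.2 (hab.trans hbt))] at hcov
  rw [h0]
  rw [sub_sub_sub_cancel_left] at h2
  linarith

/-- The variance of a Riemann sum against fractional Brownian motion, by Schur's test. -/
theorem IsFractionalBrownian.variance_stepIntegral_le {Ω : Type*} {mΩ : MeasurableSpace Ω}
    {P : Measure Ω} {H : ℝ} {X : ℝ≥0 → Ω → ℝ} (hX : IsFractionalBrownian H X P) (hH : 1 / 2 < H)
    {n : ℕ} (c : Fin n → ℝ) {s : Fin (n + 1) → ℝ≥0} (hs : Monotone s) (h0 : s 0 = 0) :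
    variance (stepIntegral X c s) P ≤ 2 * H * (s (Fin.last n) : ℝ) ^ (2 * H - 1)
      * ∑ i : Fin n, c i ^ 2 * ((s i.succ : ℝ) - s i.castSucc) := by
  rw [variance_stepIntegral hX.gaussian]
  have hnn := hX.covariance_incr_nonneg hH hs
  have hsymm : ∑ i, ∑ j, c j ^ 2 * covariance (incr X s i) (incr X s j) P
      = ∑ i, ∑ j, c i ^ 2 * covariance (incr X s i) (incr X s j) P := by
    rw [Finset.sum_comm]
    exact Finset.sum_congr rfl fun i _ => Finset.sum_congr rfl fun j _ => by rw [covariance_comm]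
  -- Nonnegative covariances allow `c i * c j ≤ (c i ^ 2 + c j ^ 2) / 2` inside the sum; symmetry
  -- then leaves only row sums.
  calc ∑ i, ∑ j, c i * c j * covariance (incr X s i) (incr X s j) P
      ≤ ∑ i, ∑ j, (c i ^ 2 * covariance (incr X s i) (incr X s j) P / 2
          + c j ^ 2 * covariance (incr X s i) (incr X s j) P / 2) := by
        gcongr with i _ j _
        nlinarith [mul_nonneg (sq_nonneg (c i - c j)) (hnn i j)]
    _ = ∑ i, ∑ j, c i ^ 2 * covariance (incr X s i) (incr X s j) P := by
        simp only [Finset.sum_add_distrib, ← Finset.sum_div]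
        rw [hsymm]
        ring
    _ ≤ ∑ i : Fin n, c i ^ 2 * (2 * H * (s (Fin.last n) : ℝ) ^ (2 * H - 1)
          * (s i.succ - s i.castSucc)) := by
        simp only [← Finset.mul_sum]
        gcongr with i _
        exact hX.sum_covariance_incr_le hH hs h0 i
    _ = _ := by
        rw [Finset.mul_sum]
        exact Finset.sum_congr rfl fun i _ => by ring

/-! ### Exponential moments of limits of Gaussian sums -/

/-- Fatou's lemma: an upper bound passes to the limit without uniform integrability. -/
theorem lintegral_exp_le_of_tendsto {Ω : Type*} {mΩ : MeasurableSpace Ω} {P : Measure Ω}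
    {Y : ℕ → Ω → ℝ} (hY : ∀ n, AEMeasurable (Y n) P) {Z : Ω → ℝ}
    (hlim : ∀ᵐ ω ∂P, Tendsto (fun n => Y n ω) atTop (𝓝 (Z ω))) {w : ℕ → ℝ} {W : ℝ}
    (hw : Tendsto w atTop (𝓝 W))
    (hb : ∀ n, ∫⁻ ω, ENNReal.ofReal (Real.exp (Y n ω)) ∂P ≤ ENNReal.ofReal (Real.exp (w n))) :
    ∫⁻ ω, ENNReal.ofReal (Real.exp (Z ω)) ∂P ≤ ENNReal.ofReal (Real.exp W) := by
  have hcont : Continuous fun x : ℝ => ENNReal.ofReal (Real.exp x) :=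
    ENNReal.continuous_ofReal.comp Real.continuous_exp
  calc ∫⁻ ω, ENNReal.ofReal (Real.exp (Z ω)) ∂P
      = ∫⁻ ω, liminf (fun n => ENNReal.ofReal (Real.exp (Y n ω))) atTop ∂P := by
        refine lintegral_congr_ae ?_
        filter_upwards [hlim] with ω h
        exact ((hcont.tendsto _).comp h).liminf_eq.symm
    _ ≤ liminf (fun n => ∫⁻ ω, ENNReal.ofReal (Real.exp (Y n ω)) ∂P) atTop :=
        lintegral_liminf_le' fun n => hcont.measurable.comp_aemeasurable (hY n)
    _ ≤ liminf (fun n => ENNReal.ofReal (Real.exp (w n))) atTop :=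
        liminf_le_liminf (Eventually.of_forall hb)
    _ = ENNReal.ofReal (Real.exp W) := ((hcont.tendsto _).comp hw).liminf_eq

/-- `I` is almost surely the limit of measurable functionals of the paths of `X` whose exponential
moments are bounded by those of centred Gaussian variables with variances tending to `V`. -/
def IsSubGaussianLimit {Ω : Type*} {mΩ : MeasurableSpace Ω} (P : Measure Ω) (X : ℝ≥0 → Ω → ℝ)
    (I : Ω → ℝ) (V : ℝ) : Prop :=
  ∃ (F : ℕ → (ℝ≥0 → ℝ) → ℝ) (v : ℕ → ℝ), (∀ n, Measurable (F n)) ∧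
    (∀ n l, ∫⁻ ω, ENNReal.ofReal (Real.exp (l * F n fun t => X t ω)) ∂P
      ≤ ENNReal.ofReal (Real.exp (l ^ 2 / 2 * v n))) ∧
    Tendsto v atTop (𝓝 V) ∧
    ∀ᵐ ω ∂P, Tendsto (fun n => F n fun t => X t ω) atTop (𝓝 (I ω))

theorem IsSubGaussianLimit.aemeasurable {Ω : Type*} {mΩ : MeasurableSpace Ω} {P : Measure Ω}
    {X : ℝ≥0 → Ω → ℝ} {I : Ω → ℝ} {V : ℝ} (h : IsSubGaussianLimit P X I V)
    (hX : ∀ t, Measurable (X t)) : AEMeasurable I P := by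
  obtain ⟨F, v, hF, -, -, hlim⟩ := h
  exact aemeasurable_of_tendsto_metrizable_ae atTop
    (fun n => ((hF n).comp (measurable_pi_lambda _ hX)).aemeasurable) hlim

theorem IsSubGaussianLimit.lintegral_exp_le {Ω : Type*} {mΩ : MeasurableSpace Ω} {P : Measure Ω}
    {X : ℝ≥0 → Ω → ℝ} {I : Ω → ℝ} {V : ℝ} (h : IsSubGaussianLimit P X I V)
    (hX : ∀ t, Measurable (X t)) (l : ℝ) :
    ∫⁻ ω, ENNReal.ofReal (Real.exp (l * I ω)) ∂P ≤ ENNReal.ofReal (Real.exp (l ^ 2 / 2 * V)) := by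
  obtain ⟨F, v, hF, hexp, hv, hlim⟩ := h
  refine lintegral_exp_le_of_tendsto (Y := fun n ω => l * F n fun t => X t ω)
    (fun n => (((hF n).comp (measurable_pi_lambda _ hX)).const_mul l).aemeasurable) ?_
    (hv.const_mul _) fun n => hexp n l
  filter_upwards [hlim] with ω hω using hω.const_mul l

/-- The approximants are measurable functionals of the two paths, so they inherit independence and
their exponential moments factor; Fatou is applied only afterwards. Independence of `I` and `J`
themselves is never needed. -/
theorem IsSubGaussianLimit.lintegral_exp_add_le {Ω : Type*} {mΩ : MeasurableSpace Ω}
    {P : Measure Ω} {X Y : ℝ≥0 → Ω → ℝ} {I J : Ω → ℝ} {V W : ℝ} (hI : IsSubGaussianLimit P X I V)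
    (hJ : IsSubGaussianLimit P Y J W) (hX : ∀ t, Measurable (X t)) (hY : ∀ t, Measurable (Y t))
    (hXY : IndepFun (fun ω t => X t ω) (fun ω t => Y t ω) P) (l : ℝ) :
    ∫⁻ ω, ENNReal.ofReal (Real.exp (l * (I ω + J ω))) ∂P
      ≤ ENNReal.ofReal (Real.exp (l ^ 2 / 2 * (V + W))) := by
  obtain ⟨F, v, hF, hexpF, hv, hlimF⟩ := hI
  obtain ⟨G, w, hG, hexpG, hw, hlimG⟩ := hJ
  have hX' := measurable_pi_lambda (fun ω t => X t ω) hX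
  have hY' := measurable_pi_lambda (fun ω t => Y t ω) hY
  refine lintegral_exp_le_of_tendsto
    (Y := fun n ω => l * ((F n fun t => X t ω) + G n fun t => Y t ω))
    (fun n => ((((hF n).comp hX').add ((hG n).comp hY')).const_mul l).aemeasurable) ?_
    ((hv.add hw).const_mul _) fun n => ?_
  · filter_upwards [hlimF, hlimG] with ω h1 h2 using (h1.add h2).const_mul l
  · have hm : Measurable fun x : ℝ => ENNReal.ofReal (Real.exp (l * x)) := by fun_prop
    have hind := hXY.comp (hm.comp (hF n)) (hm.comp (hG n))
    have hmul := lintegral_mul_eq_lintegral_mul_lintegral_of_indepFun''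
      ((hm.comp (hF n)).comp hX').aemeasurable ((hm.comp (hG n)).comp hY').aemeasurable hind
    simp only [Function.comp_apply] at hmul
    simp only [mul_add, Real.exp_add, ENNReal.ofReal_mul (Real.exp_pos _).le]
    rw [hmul]
    exact mul_le_mul' (hexpF n l) (hexpG n l)

theorem lintegral_exp_stepIntegral_le {Ω : Type*} {mΩ : MeasurableSpace Ω} {P : Measure Ω}
    {X : ℝ≥0 → Ω → ℝ} (hX : IsGaussianProcess X P) (h0 : ∀ t, ∫ ω, X t ω ∂P = 0) {n : ℕ}
    (c : Fin n → ℝ) (s : Fin (n + 1) → ℝ≥0) {v : ℝ} (hv : variance (stepIntegral X c s) P ≤ v)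
    (l : ℝ) : ∫⁻ ω, ENNReal.ofReal (Real.exp (l * stepIntegral X c s ω)) ∂P
      ≤ ENNReal.ofReal (Real.exp (l ^ 2 / 2 * v)) := by
  rw [lintegral_exp_mul_of_hasGaussianLaw (hX.hasGaussianLaw_stepIntegral c s)
    (integral_stepIntegral hX h0 c s)]
  gcongr

theorem measurable_stepIntegral_eval {n : ℕ} (c : Fin n → ℝ) (s : Fin (n + 1) → ℝ≥0) :
    Measurable (stepIntegral (fun t (x : ℝ≥0 → ℝ) => x t) c s) := by
  unfold stepIntegral
  fun_prop

theorem integral_sq_eq_toReal_eLpNorm_sq {α : Type*} {mα : MeasurableSpace α} {μ : Measure α}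
    {f : α → ℝ} (hf : MemLp f 2 μ) : ∫ x, f x ^ 2 ∂μ = (eLpNorm f 2 μ).toReal ^ 2 := by
  have h0 : 0 ≤ ∫ x, f x ^ 2 ∂μ := integral_nonneg fun _ => sq_nonneg _
  rw [hf.eLpNorm_eq_integral_rpow_norm two_ne_zero ENNReal.ofNat_ne_top]
  simp only [ENNReal.toReal_ofNat, Real.rpow_ofNat, Real.norm_eq_abs, sq_abs]
  rw [ENNReal.toReal_ofReal (by positivity), ← Real.rpow_natCast, ← Real.rpow_mul h0]
  norm_num

theorem memLp_stepFun {n : ℕ} (c : Fin n → ℝ) (s : Fin (n + 1) → ℝ≥0) (μ : Measure ℝ)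
    [IsFiniteMeasure μ] : MemLp (stepFun c s) 2 μ := by
  have h : MemLp (fun r => ∑ i : Fin n,
      (Ioc (s i.castSucc : ℝ) (s i.succ : ℝ)).indicator (fun _ => c i) r) 2 μ :=
    memLp_finsetSum _ fun i _ => (memLp_const (c i)).indicator measurableSet_Ioc
  exact h

/-- By the isometry, a step function within `1/(m+1)` of `f` in `L²` gives variance at most `(‖f‖ +
1/(m+1))²`. -/
theorem IsWienerIntegral.isSubGaussianLimit {Ω : Type*} {mΩ : MeasurableSpace Ω} {P : Measure Ω}
    {B : ℝ≥0 → Ω → ℝ} (hB : IsPreBrownianReal B P) (hBm : ∀ t, Measurable (B t)) {f : ℝ → ℝ}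
    {t : ℝ≥0} {I : Ω → ℝ} (hI : IsWienerIntegral B P f t I) :
    IsSubGaussianLimit P B I (∫ r in (0 : ℝ)..t, f r ^ 2) := by
  set μ := volume.restrict (Ioc 0 (t : ℝ)) with hμ
  have hε : ∀ m : ℕ, 0 < ENNReal.ofReal (1 / ((m : ℝ) + 1)) := fun m =>
    ENNReal.ofReal_pos.2 (by positivity)
  choose n c s hs hst hfun hint using fun m : ℕ => hI.approx _ (hε m)
  have hpath := measurable_pi_lambda (fun ω t => B t ω) hBm
  have hm : ∀ m, Measurable (stepIntegral B (c m) (s m)) := fun m =>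
    (measurable_stepIntegral_eval (c m) (s m)).comp hpath
  have hε0 : Tendsto (fun m : ℕ => ENNReal.ofReal (1 / ((m : ℝ) + 1))) atTop (𝓝 0) := by
    simpa using ENNReal.tendsto_ofReal tendsto_one_div_add_atTop_nhds_zero_nat
  have hLp : Tendsto (fun m => eLpNorm (stepIntegral B (c m) (s m) - I) 2 P) atTop (𝓝 0) := by
    refine tendsto_of_tendsto_of_tendsto_of_le_of_le tendsto_const_nhds hε0
      (fun _ => zero_le) fun m => ?_
    rw [eLpNorm_sub_comm]
    exact hint m
  -- Convergence in `L²(P)` becomes almost sure convergence along a subsequence `ns`.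
  obtain ⟨ns, hns, hae⟩ := (tendstoInMeasure_of_tendsto_eLpNorm two_ne_zero
    (fun m => (hm m).aestronglyMeasurable) hI.memLp.1 hLp).exists_seq_tendsto_ae
  have hv : Tendsto (fun m : ℕ => ((eLpNorm f 2 μ).toReal + 1 / ((m : ℝ) + 1)) ^ 2) atTop
      (𝓝 (((eLpNorm f 2 μ).toReal + 0) ^ 2)) :=
    (tendsto_const_nhds.add tendsto_one_div_add_atTop_nhds_zero_nat).pow 2
  refine ⟨fun m => stepIntegral (fun t x => x t) (c (ns m)) (s (ns m)),
    fun m => ((eLpNorm f 2 μ).toReal + 1 / ((ns m : ℝ) + 1)) ^ 2,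
    fun m => measurable_stepIntegral_eval _ _, fun m l => ?_, ?_, hae⟩
  · refine lintegral_exp_stepIntegral_le hB.isGaussianProcess hB.integral_eval (c (ns m))
      (s (ns m)) ?_ l
    have hstep := memLp_stepFun (c (ns m)) (s (ns m)) μ
    rw [variance_stepIntegral_brownian hB _ _ (hs _) (hst _), integral_sq_eq_toReal_eLpNorm_sq hstep]
    refine pow_le_pow_left₀ ENNReal.toReal_nonneg ?_ 2
    have hle : eLpNorm (stepFun (c (ns m)) (s (ns m))) 2 μ
        ≤ eLpNorm f 2 μ + ENNReal.ofReal (1 / ((ns m : ℝ) + 1)) := by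
      calc eLpNorm (stepFun (c (ns m)) (s (ns m))) 2 μ
          = eLpNorm (f - (f - stepFun (c (ns m)) (s (ns m)))) 2 μ := by rw [sub_sub_cancel]
        _ ≤ eLpNorm f 2 μ + eLpNorm (f - stepFun (c (ns m)) (s (ns m))) 2 μ :=
            eLpNorm_sub_le hI.memLp_fun.1 (hI.memLp_fun.1.sub hstep.1) one_le_two
        _ ≤ _ := by gcongr; exact hfun _
    have h := ENNReal.toReal_mono (by finiteness [hI.memLp_fun.2.ne]) hle
    rwa [ENNReal.toReal_add hI.memLp_fun.2.ne ENNReal.ofReal_ne_top,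
      ENNReal.toReal_ofReal (by positivity)] at h
  · rw [intervalIntegral.integral_of_le t.coe_nonneg, integral_sq_eq_toReal_eLpNorm_sq hI.memLp_fun]
    rw [add_zero] at hv
    exact hv.comp hns.tendsto_atTop

/-! ### Riemann sums against fractional Brownian motion -/

/-- The partition of `[0, t]` into `n + 1` intervals of equal length. -/
noncomputable def uniformPartition (t : ℝ≥0) (n : ℕ) (i : Fin (n + 1 + 1)) : ℝ≥0 :=
  t * ((i : ℕ) : ℝ≥0) / ((n : ℝ≥0) + 1)

theorem monotone_uniformPartition (t : ℝ≥0) (n : ℕ) : Monotone (uniformPartition t n) := by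
  intro i j hij
  unfold uniformPartition
  have : ((i : ℕ) : ℝ≥0) ≤ ((j : ℕ) : ℝ≥0) := Nat.cast_le.2 hij
  gcongr

theorem uniformPartition_zero (t : ℝ≥0) (n : ℕ) : uniformPartition t n 0 = 0 := by
  simp [uniformPartition]

theorem uniformPartition_last (t : ℝ≥0) (n : ℕ) : uniformPartition t n (Fin.last (n + 1)) = t := by
  simp only [uniformPartition, Fin.val_last, Nat.cast_add, Nat.cast_one]
  exact mul_div_cancel_right₀ _ (by positivity)

theorem uniformPartition_succ_sub (t : ℝ≥0) (n : ℕ) (i : Fin (n + 1)) :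
    (uniformPartition t n i.succ : ℝ) - uniformPartition t n i.castSucc = t / ((n : ℝ) + 1) := by
  simp [uniformPartition]
  ring

/-- Tagging each cell at a minimum of `b²` produces a lower Darboux sum. -/
theorem exists_tags_sum_sq_le {b : ℝ → ℝ} {n : ℕ} {s : Fin (n + 1) → ℝ≥0} (hs : Monotone s)
    (h0 : s 0 = 0) (hb : ContinuousOn b (Icc 0 (s (Fin.last n) : ℝ))) :
    ∃ ξ : Fin n → ℝ≥0, (∀ i : Fin n, s i.castSucc ≤ ξ i ∧ ξ i ≤ s i.succ) ∧
      ∑ i : Fin n, b (ξ i) ^ 2 * ((s i.succ : ℝ) - s i.castSucc)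
        ≤ ∫ r in (0 : ℝ)..s (Fin.last n), b r ^ 2 := by
  have hle : ∀ i : Fin n, (s i.castSucc : ℝ) ≤ s i.succ := fun i =>
    NNReal.coe_le_coe.2 (hs (Fin.castSucc_lt_succ).le)
  have hsub : ∀ i : Fin n, Icc (s i.castSucc : ℝ) (s i.succ) ⊆ Icc 0 (s (Fin.last n) : ℝ) :=
    fun i => Icc_subset_Icc (s i.castSucc).2 (NNReal.coe_le_coe.2 (hs (Fin.le_last _)))
  have hb2 : ContinuousOn (fun r => b r ^ 2) (Icc 0 (s (Fin.last n) : ℝ)) := hb.pow 2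
  choose ξ hξ hmin using fun i : Fin n => isCompact_Icc.exists_isMinOn
    (nonempty_Icc.2 (hle i)) (hb2.mono (hsub i))
  have hξ0 : ∀ i, 0 ≤ ξ i := fun i => (s i.castSucc).2.trans (hξ i).1
  have hII : ∀ i : Fin (n + 1), IntervalIntegrable (fun r => b r ^ 2) volume 0 (s i) := fun i =>
    (hb2.mono (by
      rw [uIcc_of_le (s i).coe_nonneg]
      exact Icc_subset_Icc le_rfl (NNReal.coe_le_coe.2 (hs (Fin.le_last _))))).intervalIntegrable
  refine ⟨fun i => ⟨ξ i, hξ0 i⟩, fun i => ⟨(hξ i).1, (hξ i).2⟩, ?_⟩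
  have htel := Fin.sum_succ_sub_castSucc fun i : Fin (n + 1) => ∫ r in (0 : ℝ)..s i, b r ^ 2
  rw [h0, NNReal.coe_zero, intervalIntegral.integral_same, sub_zero] at htel
  rw [← htel]
  refine Finset.sum_le_sum fun i _ => ?_
  rw [intervalIntegral.integral_interval_sub_left (hII _) (hII _)]
  have hc : ∫ _ in (s i.castSucc : ℝ)..s i.succ, b (ξ i) ^ 2
      ≤ ∫ r in (s i.castSucc : ℝ)..s i.succ, b r ^ 2 :=
    intervalIntegral.integral_mono_on (hle i) intervalIntegrable_const
      ((hII _).symm.trans (hII _)) fun r hr => hmin i hr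
  rw [intervalIntegral.integral_const, smul_eq_mul, mul_comm] at hc
  exact hc

/-- The pathwise integral is the limit for every choice of tags, so the minimising ones may be used;
the variance bound then holds for every `n`, and the sequence of bounds is constant. -/
theorem IsFractionalBrownian.isSubGaussianLimit {Ω : Type*} {mΩ : MeasurableSpace Ω}
    {P : Measure Ω} {H : ℝ} {X : ℝ≥0 → Ω → ℝ} (hX : IsFractionalBrownian H X P) (hH : 1 / 2 < H)
    {b : ℝ → ℝ} {t : ℝ≥0} (hb : ContinuousOn b (Icc 0 (t : ℝ))) {J : Ω → ℝ}
    (hJ : ∀ᵐ ω ∂P, IsStieltjesIntegral b (fun s => X s ω) t (J ω)) :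
    IsSubGaussianLimit P X J
      (2 * H * (t : ℝ) ^ (2 * H - 1) * ∫ r in (0 : ℝ)..t, b r ^ 2) := by
  have htags := fun n : ℕ => exists_tags_sum_sq_le (b := b) (monotone_uniformPartition t n)
    (uniformPartition_zero t n) (by rwa [uniformPartition_last])
  choose ξ hξ hsum using htags
  refine ⟨fun n => stepIntegral (fun t x => x t) (fun i => b (ξ n i)) (uniformPartition t n),
    fun _ => _, fun n => measurable_stepIntegral_eval _ _, fun n l => ?_, tendsto_const_nhds, ?_⟩
  · refine lintegral_exp_stepIntegral_le hX.gaussian hX.centred (fun i => b (ξ n i))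
      (uniformPartition t n) ?_ l
    refine (hX.variance_stepIntegral_le hH _ (monotone_uniformPartition t n)
      (uniformPartition_zero t n)).trans ?_
    have h := hsum n
    rw [uniformPartition_last] at h ⊢
    have h2 : 0 ≤ 2 * H * (t : ℝ) ^ (2 * H - 1) := by positivity
    exact mul_le_mul_of_nonneg_left h h2
  · filter_upwards [hJ] with ω hω
    rw [Metric.tendsto_atTop]
    intro ε hε
    obtain ⟨δ, hδ, hR⟩ := hω ε hε
    have hmesh : Tendsto (fun n : ℕ => (t : ℝ) / ((n : ℝ) + 1)) atTop (𝓝 0) := by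
      simpa [div_eq_mul_inv] using
        (tendsto_one_div_add_atTop_nhds_zero_nat (𝕜 := ℝ)).const_mul (t : ℝ)
    obtain ⟨M, hM⟩ := eventually_atTop.1 (hmesh.eventually (gt_mem_nhds hδ))
    refine ⟨M, fun n hn => ?_⟩
    exact hR (n + 1) (uniformPartition t n) (ξ n) (monotone_uniformPartition t n)
      (uniformPartition_zero t n) (uniformPartition_last t n) (hξ n)
      fun i => by rw [uniformPartition_succ_sub]; exact hM n hn

/-! ### Processes with continuous paths -/

/-- A process with almost surely continuous paths has a jointly measurable version whose paths
agree almost surely with the given ones at all times. -/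
theorem exists_measurable_version {Ω : Type*} {mΩ : MeasurableSpace Ω} {P : Measure Ω}
    {X : ℝ≥0 → Ω → ℝ} (hX : ∀ t, AEMeasurable (X t) P)
    (hc : ∀ᵐ ω ∂P, Continuous fun t => X t ω) :
    ∃ Y : ℝ × Ω → ℝ, Measurable Y ∧ ∀ᵐ ω ∂P, ∀ r : ℝ, Y (r, ω) = X r.toNNReal ω := by
  choose X' hX' hXX' using hX
  let g : ℕ → ℕ → ℝ≥0 := fun n k => Real.toNNReal ((k : ℝ) / n)
  -- Sampling at the grid point of mesh `1/n` just below `r` involves countably many times, which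
  -- gives joint measurability and a single exceptional null set.
  let Z : ℕ → ℝ × Ω → ℝ := fun n q => X' (g n ⌊max q.1 0 * (n : ℝ)⌋₊) q.2
  have hZ : ∀ n, Measurable (Z n) := fun n => by
    have h1 : Measurable fun q : ℕ × Ω => X' (g n q.1) q.2 :=
      measurable_from_prod_countable_right fun k => hX' (g n k)
    have h2 : Measurable fun q : ℝ × Ω => max q.1 0 * (n : ℝ) := by fun_prop
    exact h1.comp ((Nat.measurable_floor.comp h2).prodMk measurable_snd)
  refine ⟨fun q => limsup (fun n => Z n q) atTop, Measurable.limsup hZ, ?_⟩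
  have hmk : ∀ᵐ ω ∂P, ∀ n k, X (g n k) ω = X' (g n k) ω :=
    ae_all_iff.2 fun n => ae_all_iff.2 fun k => hXX' (g n k)
  filter_upwards [hc, hmk] with ω hω hω' r
  have hlim := (tendsto_nat_floor_mul_div_atTop (le_max_right r 0)).comp
    tendsto_natCast_atTop_atTop
  have hXr := ((hω.comp continuous_real_toNNReal).tendsto (max r 0)).comp hlim
  have hr : (max r 0).toNNReal = r.toNNReal := by
    rcases le_total r 0 with h | h
    · rw [max_eq_right h, Real.toNNReal_zero, Real.toNNReal_of_nonpos h]
    · rw [max_eq_left h]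
  simp only [Function.comp_apply, hr] at hXr
  refine Tendsto.limsup_eq (hXr.congr fun n => ?_)
  exact hω' n _

theorem lintegral_exp_path_swap {Ω : Type*} {mΩ : MeasurableSpace Ω} {P : Measure Ω} [SFinite P]
    {X : ℝ≥0 → Ω → ℝ} (hX : ∀ t, AEMeasurable (X t) P)
    (hc : ∀ᵐ ω ∂P, Continuous fun t => X t ω) (μ : Measure ℝ) [SFinite μ] {w : ℝ → ℝ}
    (hw : AEMeasurable w μ) (β : ℝ) :
    AEMeasurable (fun ω => ∫⁻ r, ENNReal.ofReal (Real.exp (w r + β * X r.toNNReal ω)) ∂μ) P ∧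
    ∫⁻ ω, ∫⁻ r, ENNReal.ofReal (Real.exp (w r + β * X r.toNNReal ω)) ∂μ ∂P
      = ∫⁻ r, ∫⁻ ω, ENNReal.ofReal (Real.exp (w r + β * X r.toNNReal ω)) ∂P ∂μ := by
  obtain ⟨Y, hY, hYX⟩ := exists_measurable_version hX hc
  have hYm : AEMeasurable (Function.uncurry fun ω r =>
      ENNReal.ofReal (Real.exp (w r + β * Y (r, ω)))) (P.prod μ) :=
    ((hw.comp_snd.add (((hY.comp measurable_swap).const_mul β).aemeasurable)).exp).ennreal_ofReal
  have hpath : (fun ω => ∫⁻ r, ENNReal.ofReal (Real.exp (w r + β * Y (r, ω))) ∂μ)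
      =ᵐ[P] fun ω => ∫⁻ r, ENNReal.ofReal (Real.exp (w r + β * X r.toNNReal ω)) ∂μ := by
    filter_upwards [hYX] with ω hω
    simp only [hω]
  refine ⟨hYm.lintegral_prod_right'.congr hpath, ?_⟩
  rw [← lintegral_congr_ae hpath, lintegral_lintegral_swap hYm]
  refine lintegral_congr fun r => lintegral_congr_ae ?_
  filter_upwards [hYX] with ω hω
  rw [hω]

/-! ### First passage and Markov's inequality -/

/-- If the integral up to `T` were below `L`, the bound `M` would keep it below `L` up to some `T +
δ`, forcing the infimum beyond `T`. The interval in `hf` reaches past `T` to leave this room. -/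
theorem le_lintegral_of_sInf_le {L : ℝ≥0∞} {T : ℝ} (hT : 0 ≤ T) {f : ℝ → ℝ≥0∞} {M : ℝ}
    (hf : ∀ r ∈ Ioc 0 (T + 1), f r ≤ ENNReal.ofReal M)
    (hL : sInf ((fun t : ℝ≥0 => (t : ℝ≥0∞)) '' {t : ℝ≥0 | 0 < t ∧
      L ≤ ∫⁻ r in Ioc 0 (t : ℝ), f r}) ≤ ENNReal.ofReal T) :
    L ≤ ∫⁻ r in Ioc 0 T, f r := by
  by_contra! hlt
  have hcont : Tendsto (fun δ : ℝ => (∫⁻ r in Ioc 0 T, f r)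
      + ENNReal.ofReal M * ENNReal.ofReal δ) (𝓝[>] 0) (𝓝 ((∫⁻ r in Ioc 0 T, f r)
      + ENNReal.ofReal M * ENNReal.ofReal 0)) :=
    (tendsto_const_nhds.add (ENNReal.Tendsto.const_mul
      (ENNReal.continuous_ofReal.tendsto 0) (Or.inr ENNReal.ofReal_ne_top))).mono_left
      nhdsWithin_le_nhds
  rw [ENNReal.ofReal_zero, mul_zero, add_zero] at hcont
  obtain ⟨δ, hδL, hδ⟩ := ((hcont.eventually (gt_mem_nhds hlt)).and
    (Ioc_mem_nhdsGT (zero_lt_one' ℝ))).exists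
  have hTδ : ENNReal.ofReal T < ENNReal.ofReal (T + δ) :=
    (ENNReal.ofReal_lt_ofReal_iff (by linarith [hδ.1])).2 (by linarith [hδ.1])
  obtain ⟨_, ⟨t, ⟨-, ht⟩, rfl⟩, htlt⟩ := sInf_lt_iff.1 (hL.trans_lt hTδ)
  have htT : (t : ℝ) < T + δ := by
    have h : ENNReal.ofReal (t : ℝ) < ENNReal.ofReal (T + δ) := by
      rwa [ENNReal.ofReal_coe_nnreal]
    exact (ENNReal.ofReal_lt_ofReal_iff (by linarith [hδ.1])).1 h
  refine (ht.trans ?_).not_gt hδL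
  calc ∫⁻ r in Ioc 0 (t : ℝ), f r
      ≤ ∫⁻ r in Ioc 0 T ∪ Ioc T (T + δ), f r :=
        lintegral_mono_set (by
          rw [Ioc_union_Ioc_eq_Ioc hT (by linarith [hδ.1])]
          exact Ioc_subset_Ioc_right htT.le)
    _ ≤ (∫⁻ r in Ioc 0 T, f r) + ∫⁻ r in Ioc T (T + δ), f r := lintegral_union_le _ _ _
    _ ≤ (∫⁻ r in Ioc 0 T, f r) + ∫⁻ _ in Ioc T (T + δ), ENNReal.ofReal M := by
        refine add_le_add le_rfl (setLIntegral_mono' measurableSet_Ioc fun r hr =>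
          hf r ⟨hT.trans_lt hr.1, hr.2.trans (by linarith [hδ.2])⟩)
    _ = (∫⁻ r in Ioc 0 T, f r) + ENNReal.ofReal M * ENNReal.ofReal δ := by
        rw [setLIntegral_const, Real.volume_Ioc, add_sub_cancel_left]

theorem continuousOn_primitive_of_forall {f : ℝ → ℝ}
    (hf : ∀ t : ℝ, 0 ≤ t → IntervalIntegrable f volume 0 t) (R : ℝ) :
    ContinuousOn (fun t => ∫ s in (0 : ℝ)..t, f s) (Icc 0 R) := by
  rcases lt_or_ge R 0 with hR | hR
  · rw [Icc_eq_empty hR.not_ge]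
    exact continuousOn_empty _
  · have h := intervalIntegral.continuousOn_primitive_interval (μ := volume) (f := f) (a := 0)
      (b := R) (by
        rw [uIcc_of_le hR]
        exact (intervalIntegrable_iff_integrableOn_Icc_of_le hR).1 (hf R hR))
    rwa [uIcc_of_le hR] at h

/-- Markov's inequality for the occupation functional that defines `τ*`. -/
theorem measureReal_tauStar_le {Ω : Type*} {mΩ : MeasurableSpace Ω} {P : Measure Ω}
    [IsProbabilityMeasure P] {N : ℝ≥0 → Ω → ℝ} (hN : ∀ t, AEMeasurable (N t) P)
    (hc : ∀ᵐ ω ∂P, Continuous fun t => N t ω) {C β lam0 p T : ℝ} (hC : 0 < C) (hβ : 0 < β)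
    (hp : 0 ≤ p) (hT : 0 ≤ T) {k a : ℝ → ℝ} (hk : ∀ R, ContinuousOn (halfSq k) (Icc 0 R))
    (ha : ∀ R, ContinuousOn (halfSq a) (Icc 0 R)) {G : ℝ → ℝ} (hG : ContinuousOn G (Icc 0 T))
    (hG0 : ∀ r ∈ Icc 0 T, 0 ≤ G r)
    (hbound : ∀ r ∈ Ioc 0 T, ∫⁻ ω, ENNReal.ofReal (Real.exp
      (-β * (lam0 * halfSq k r + halfSq a r) + β * N r.toNNReal ω)) ∂P ≤ ENNReal.ofReal (G r)) :
    P.real {ω | tauStar C β lam0 p k a N ω ≤ ENNReal.ofReal T}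
      ≤ C * β * p ^ β * ∫ t in (0 : ℝ)..T, G t := by
  set w : ℝ → ℝ := fun r => -β * (lam0 * halfSq k r + halfSq a r) with hw
  have hwc : ∀ R, ContinuousOn w (Icc 0 R) := fun R =>
    continuousOn_const.mul ((continuousOn_const.mul (hk R)).add (ha R))
  obtain ⟨hFm, hFswap⟩ := lintegral_exp_path_swap hN hc (volume.restrict (Ioc 0 T))
    ((((hwc T).mono Ioc_subset_Icc_self).aemeasurable measurableSet_Ioc)) β
  set F : Ω → ℝ≥0∞ := fun ω =>
    ∫⁻ r in Ioc 0 T, ENNReal.ofReal (Real.exp (w r + β * N r.toNNReal ω)) with hF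
  have hGint : IntegrableOn G (Ioc 0 T) := hG.integrableOn_Icc.mono_set Ioc_subset_Icc_self
  have hFG : ∫⁻ ω, F ω ∂P ≤ ENNReal.ofReal (∫ t in (0 : ℝ)..T, G t) := by
    rw [hFswap, intervalIntegral.integral_of_le hT, ofReal_integral_eq_lintegral_ofReal hGint]
    · exact setLIntegral_mono' measurableSet_Ioc hbound
    · filter_upwards [ae_restrict_mem measurableSet_Ioc] with r hr
      exact hG0 r (Ioc_subset_Icc_self hr)
  have hGI : 0 ≤ ∫ t in (0 : ℝ)..T, G t := intervalIntegral.integral_nonneg hT hG0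
  have hsub : P {ω | tauStar C β lam0 p k a N ω ≤ ENNReal.ofReal T}
      ≤ P {ω | tauLevel C β p ≤ F ω} := by
    refine measure_mono_ae ?_
    filter_upwards [hc] with ω hω hτ
    have hcont : ContinuousOn (fun r => Real.exp (w r + β * N r.toNNReal ω)) (Icc 0 (T + 1)) :=
      ((hwc _).add ((hω.comp continuous_real_toNNReal).const_mul β).continuousOn).rexp
    obtain ⟨M, hM⟩ := isCompact_Icc.exists_bound_of_continuousOn hcont
    refine le_lintegral_of_sInf_le hT (M := M) (fun r hr => ENNReal.ofReal_le_ofReal ?_) hτ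
    exact (le_abs_self _).trans (hM r (Ioc_subset_Icc_self hr))
  have hMarkov := (mul_meas_ge_le_lintegral₀ hFm (tauLevel C β p)).trans hFG
  have hCβ : 0 < C * β := mul_pos hC hβ
  rw [measureReal_def]
  refine ENNReal.toReal_le_of_le_ofReal (by positivity) (hsub.trans ?_)
  -- When `p = 0` the level is infinite, and the finite mean of `F` makes the event null.
  rcases hp.eq_or_lt with rfl | hp'
  · have htop : tauLevel C β 0 = ⊤ := by
      rw [tauLevel, ENNReal.ofReal_zero, ENNReal.zero_rpow_of_neg (neg_neg_of_pos hβ)]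
      exact ENNReal.mul_top (ENNReal.inv_ne_zero.2 ENNReal.ofReal_ne_top)
    rw [htop] at hMarkov ⊢
    have h0 : P {ω | ⊤ ≤ F ω} = 0 := by
      by_contra h
      rw [ENNReal.top_mul h] at hMarkov
      exact ENNReal.ofReal_ne_top (top_le_iff.1 hMarkov)
    rw [h0]
    exact zero_le
  · have hinv : (tauLevel C β p)⁻¹ = ENNReal.ofReal (C * β * p ^ β) := by
      rw [tauLevel, ENNReal.ofReal_rpow_of_pos hp', ← ENNReal.ofReal_inv_of_pos hCβ,
        ← ENNReal.ofReal_mul (by positivity), ← ENNReal.ofReal_inv_of_pos (by positivity),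
        Real.rpow_neg hp, mul_inv, inv_inv, inv_inv]
    have hne0 : tauLevel C β p ≠ 0 := by
      rw [← ENNReal.inv_ne_top, hinv]
      exact ENNReal.ofReal_ne_top
    have hnetop : tauLevel C β p ≠ ⊤ := by
      rw [← ENNReal.inv_ne_zero, hinv]
      exact (ENNReal.ofReal_pos.2 (by positivity)).ne'
    rw [ENNReal.ofReal_mul (by positivity), ← hinv, mul_comm, ← div_eq_mul_inv]
    exact ENNReal.le_div_iff_mul_le (Or.inl hne0) (Or.inl hnetop) |>.2 (by rwa [mul_comm])

/-! ### The two tail bounds -/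

theorem lintegral_exp_const_add {Ω : Type*} {mΩ : MeasurableSpace Ω} {P : Measure Ω} {c v : ℝ}
    {Z : Ω → ℝ} (h : ∫⁻ ω, ENNReal.ofReal (Real.exp (Z ω)) ∂P ≤ ENNReal.ofReal (Real.exp v)) :
    ∫⁻ ω, ENNReal.ofReal (Real.exp (c + Z ω)) ∂P ≤ ENNReal.ofReal (Real.exp (c + v)) := by
  simp only [Real.exp_add, ENNReal.ofReal_mul (Real.exp_pos _).le]
  rw [lintegral_const_mul' _ _ ENNReal.ofReal_ne_top]
  gcongr

theorem Real.exp_add_le_exp_two_mul_add (x y : ℝ) :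
    Real.exp (x + y) ≤ Real.exp (2 * x) + Real.exp (2 * y) := by
  rw [Real.exp_add, two_mul, two_mul, Real.exp_add, Real.exp_add]
  nlinarith [sq_nonneg (Real.exp x - Real.exp y), mul_pos (Real.exp_pos x) (Real.exp_pos y)]

theorem theorem3p3
    -- the domain, the semigroup on L²(D), the eigenfunctions, the initial value
    {d : ℕ} (D : Set (EuclideanSpace ℝ (Fin d))) (hD : IsOpen D) (hDb : Bornology.IsBounded D)
    (S : ℝ≥0 → L2 D →L[ℝ] L2 D) (hS : IsContractionSemigroup S)
    (lam0 : ℝ) (psi0 phi0 : L2 D) (hL : ArePositiveEigenfunctions D S lam0 psi0 phi0)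
    (phi : EuclideanSpace ℝ (Fin d) → ℝ) (hphi : MemLp phi ∞ (volume.restrict D))
    (hphi0 : ∀ᵐ x ∂(volume.restrict D), 0 ≤ phi x)
    -- the nonlinearity
    (g : ℝ → ℝ) (hg : LocallyLipschitz g) (hg0 : ∀ z, 0 ≤ g z)
    (C β : ℝ) (hC : 0 < C) (hβ : 0 < β) (hgC : ∀ z : ℝ, 0 < z → C * z ^ (1 + β) ≤ g z)
    -- the coefficients
    (k a b : ℝ → ℝ) (hk : ∀ t : ℝ, 0 ≤ t → IntervalIntegrable (fun s => k s ^ 2) volume 0 t)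
    (ha : ContinuousOn a (Ici 0))
    (H : ℝ) (hH : 1 / 2 < H) (hH1 : H < 1) (α : ℝ≥0) (hα : 1 - H < α)
    (hb : ∀ R : ℝ, ∃ c : ℝ≥0, HolderOnWith c α b (Icc 0 R))
    -- the noise
    {Ω : Type*} {mΩ : MeasurableSpace Ω} (P : Measure Ω) [IsProbabilityMeasure P]
    (ℱ : Filtration ℝ≥0 mΩ) (B BH : ℝ≥0 → Ω → ℝ)
    (hB : IsBrownianReal B P) (hBad : Adapted ℱ B)
    (hBH : IsFractionalBrownian H BH P) (hBHad : Adapted ℱ BH)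
    (N : ℝ≥0 → Ω → ℝ) (hN : IsMixedNoise P a b B BH N)
    (T : ℝ) (hT : 0 ≤ T) :
    ((∃ W : ℝ≥0 → Ω → ℝ, IsBrownianReal W P ∧ Adapted ℱ W ∧
        ∀ t : ℝ≥0, IsWienerIntegral W P (fbmKernel H t) t (BH t)) →
      P.real {ω | tauStar C β lam0 (pairing D phi phi0) k a N ω ≤ ENNReal.ofReal T} ≤
        C * β * pairing D phi phi0 ^ β *
          ∫ t in (0 : ℝ)..T,
            (Real.exp (-β * lam0 * (∫ s in (0 : ℝ)..t, k s ^ 2)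
                + 2 * β ^ 2 * ∫ s in (0 : ℝ)..t, a s ^ 2)
              + Real.exp (-β * (∫ s in (0 : ℝ)..t, a s ^ 2)
                + 4 * β ^ 2 * H * t ^ (2 * H - 1) * ∫ s in (0 : ℝ)..t, b s ^ 2))) ∧
    (IndepFun (fun ω t => B t ω) (fun ω t => BH t ω) P →
      P.real {ω | tauStar C β lam0 (pairing D phi phi0) k a N ω ≤ ENNReal.ofReal T} ≤
        C * β * pairing D phi phi0 ^ β *
          ∫ t in (0 : ℝ)..T,
            Real.exp (-β * lam0 * halfSq k t
              + (β ^ 2 - β) / 2 * (∫ s in (0 : ℝ)..t, a s ^ 2)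
              + β ^ 2 * H * t ^ (2 * H - 1) * ∫ s in (0 : ℝ)..t, b s ^ 2)) := by
  have hp : 0 ≤ pairing D phi phi0 := by
    refine integral_nonneg_of_ae ?_
    filter_upwards [hphi0, hL.phi0_pos] with x h1 h2 using mul_nonneg h1 h2.le
  have ha2 : ∀ t : ℝ, 0 ≤ t → IntervalIntegrable (fun s => a s ^ 2) volume 0 t := fun t ht =>
    ((ha.pow 2).mono (by rw [uIcc_of_le ht]; exact Icc_subset_Ici_self)).intervalIntegrable
  have hbc : ∀ R, ContinuousOn b (Icc 0 R) := fun R => by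
    obtain ⟨c, hc⟩ := hb R
    exact hc.continuousOn (NNReal.coe_pos.1 (by linarith))
  have hb2 : ∀ t : ℝ, 0 ≤ t → IntervalIntegrable (fun s => b s ^ 2) volume 0 t := fun t ht =>
    (((hbc t).pow 2).mono (by rw [uIcc_of_le ht])).intervalIntegrable
  have hkI := continuousOn_primitive_of_forall hk
  have haI := continuousOn_primitive_of_forall ha2
  have hbI := continuousOn_primitive_of_forall hb2
  have hK : ∀ R, ContinuousOn (halfSq k) (Icc 0 R) := fun R => continuousOn_const.mul (hkI R)
  have hA : ∀ R, ContinuousOn (halfSq a) (Icc 0 R) := fun R => continuousOn_const.mul (haI R)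
  have hpow : ContinuousOn (fun t : ℝ => t ^ (2 * H - 1)) (Icc 0 T) :=
    (Real.continuous_rpow_const (by linarith)).continuousOn
  have hBm : ∀ t, Measurable (B t) := fun t => (hBad t).mono (ℱ.le t) le_rfl
  have hBHm : ∀ t, Measurable (BH t) := fun t => (hBHad t).mono (ℱ.le t) le_rfl
  have hint : ∀ t : ℝ≥0, ∃ I J : Ω → ℝ,
      IsSubGaussianLimit P B I (∫ r in (0 : ℝ)..t, a r ^ 2) ∧
      IsSubGaussianLimit P BH J (2 * H * (t : ℝ) ^ (2 * H - 1) * ∫ r in (0 : ℝ)..t, b r ^ 2) ∧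
      ∀ᵐ ω ∂P, N t ω = I ω + J ω := fun t => by
    obtain ⟨I, J, hI, hJ, hIJ⟩ := hN.eq_integrals t
    exact ⟨I, J, hI.isSubGaussianLimit hB.toIsPreBrownianReal hBm,
      hBH.isSubGaussianLimit hH (hbc t) hJ, hIJ⟩
  have hNm : ∀ t, AEMeasurable (N t) P := fun t => by
    obtain ⟨I, J, hI, hJ, hIJ⟩ := hint t
    exact ((hI.aemeasurable hBm).add (hJ.aemeasurable hBHm)).congr (hIJ.mono fun ω h => h.symm)
  refine ⟨fun _ => ?_, fun hind => ?_⟩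
  · refine measureReal_tauStar_le hNm hN.cont hC hβ hp hT hK hA ?_
      (fun r _ => by positivity) fun r hr => ?_
    · exact ((continuousOn_const.mul (hkI T)).add (continuousOn_const.mul (haI T))).rexp.add
        ((continuousOn_const.mul (haI T)).add ((continuousOn_const.mul hpow).mul (hbI T))).rexp
    · obtain ⟨I, J, hI, hJ, hIJ⟩ := hint r.toNNReal
      rw [Real.coe_toNNReal r hr.1.le] at hI hJ
      -- The drift `lam0 * K` is grouped with `I` and the drift `A` with `J`. Doubling cancels the
      -- `1/2` in `halfSq`, and the moment parameter `2 * β` yields the constants `2β²` and `4β²H`.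
      have h1 := lintegral_exp_const_add (c := -2 * β * lam0 * halfSq k r)
        (hI.lintegral_exp_le hBm (2 * β))
      have h2 := lintegral_exp_const_add (c := -2 * β * halfSq a r)
        (hJ.lintegral_exp_le hBHm (2 * β))
      calc ∫⁻ ω, ENNReal.ofReal (Real.exp
            (-β * (lam0 * halfSq k r + halfSq a r) + β * N r.toNNReal ω)) ∂P
          ≤ ∫⁻ ω, (ENNReal.ofReal (Real.exp (-2 * β * lam0 * halfSq k r + 2 * β * I ω))
              + ENNReal.ofReal (Real.exp (-2 * β * halfSq a r + 2 * β * J ω))) ∂P := by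
            refine lintegral_mono_ae ?_
            filter_upwards [hIJ] with ω hω
            rw [← ENNReal.ofReal_add (Real.exp_pos _).le (Real.exp_pos _).le, hω]
            refine ENNReal.ofReal_le_ofReal ?_
            convert Real.exp_add_le_exp_two_mul_add (-β * lam0 * halfSq k r + β * I ω)
              (-β * halfSq a r + β * J ω) using 2 <;> ring_nf
        _ = (∫⁻ ω, ENNReal.ofReal (Real.exp (-2 * β * lam0 * halfSq k r + 2 * β * I ω)) ∂P)
              + ∫⁻ ω, ENNReal.ofReal (Real.exp (-2 * β * halfSq a r + 2 * β * J ω)) ∂P :=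
            lintegral_add_left' ((((hI.aemeasurable hBm).const_mul _).const_add _).exp.ennreal_ofReal)
              _
        _ ≤ _ := by
            rw [ENNReal.ofReal_add (Real.exp_pos _).le (Real.exp_pos _).le]
            refine add_le_add (h1.trans_eq ?_) (h2.trans_eq ?_) <;> congr 2 <;>
              simp only [halfSq] <;> ring
  · refine measureReal_tauStar_le hNm hN.cont hC hβ hp hT hK hA ?_
      (fun r _ => by positivity) fun r hr => ?_
    · exact (((continuousOn_const.mul (hK T)).add (continuousOn_const.mul (haI T))).add
        ((continuousOn_const.mul hpow).mul (hbI T))).rexp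
    · obtain ⟨I, J, hI, hJ, hIJ⟩ := hint r.toNNReal
      rw [Real.coe_toNNReal r hr.1.le] at hI hJ
      -- The moment parameter stays `β`: the Itô variance contributes `β²/2`, which combines with
      -- `-β/2` from `A`.
      have h := lintegral_exp_const_add (c := -β * (lam0 * halfSq k r + halfSq a r))
        (hI.lintegral_exp_add_le hJ hBm hBHm hind β)
      refine (lintegral_congr_ae ?_).trans_le (h.trans_eq ?_)
      · filter_upwards [hIJ] with ω hω
        rw [hω]
      · congr 2
        simp only [halfSq]
        ring
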